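/- Let $\Phi_1,\Phi_2$ be independent homogeneous Poisson point processes in $\mathbb{R}^2$ with densities $\lambda_1,\lambda_2>0$, let $D>0$, let $\Xi_D=\bigcup_{y\in\Phi_1}b(y,D)$ be the union of the open discs (holes) of radius $D$ centred at the points of $\Phi_1$, and let $\Psi=\Phi_2\setminus\Xi_D$ be the resulting Poisson hole process. Let $P>0$, $\alpha>2$, and let the points $x$ of $\Phi_2$ carry i.i.d. fading gains $h_x\sim\exp(1)$, independent of $(\Phi_1,\Phi_2)$. The typical point is placed at the origin $o$ as an additional point of the baseline process that is not covered by a hole; that is, one conditions on the event $\{o\notin\Xi_D\}$ that $\Phi_1$ has no point in $b(o,D)$. The interference at the typical point is $$I=\sum_{x\in\Psi}P\,h_x\,\|x\|^{-\alpha}\in[0,\infty],$$ and its Laplace transform is $\mathcal{L}_I(s)=\mathbb{E}\left[e^{-sI}\mid o\notin\Xi_D\right]$ (with $e^{-\infty}=0$). Then for every $s>0$ $$\mathcal{L}_I(s)\ \ge\ \exp\left(-\pi\lambda_2\frac{(sP)^{2/\alpha}}{\operatorname{sinc}(2/\alpha)}\right)\int_D^\infty \exp\left(g(v_1)\right)\,2\pi\lambda_1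 v_1\,e^{-\pi\lambda_1(v_1^2-D^2)}\,dv_1,$$ where $\operatorname{sinc}(x)=\frac{\sin(\pi x)}{\pi x}$ and $$g(v_1)=\int_{v_1-D}^{v_1+D}\arccos\left(\frac{r^2+v_1^2-D^2}{2v_1r}\right)\frac{2\lambda_2}{1+\frac{r^\alpha}{Ps}}\,r\,dr ,\qquad v_1>D.$$ Both integrals converge absolutely. -/

import Mathlib

open MeasureTheory ProbabilityTheory
open scoped ENNReal NNReal

noncomputable section

namespace PoissonHole

/-- The Euclidean plane `ℝ²`. -/
abbrev Plane : Type := EuclideanSpace ℝ (Fin 2)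

/-- The random set of points of a point process given by an enumeration `X` of its points. -/
def points {Ω : Type*} (X : ℕ → Ω → Plane) (ω : Ω) : Set Plane :=
  Set.range fun i => X i ω

/-- The number of points (counted with multiplicity) of the point process `X` in the set `B`. -/
def pointCount {Ω : Type*} (X : ℕ → Ω → Plane) (B : Set Plane) (ω : Ω) : ℕ∞ :=
  {i : ℕ | X i ω ∈ B}.encard

/-- `X` enumerates the points of a homogeneous Poisson point process of density `lam` in the plane:
the number of points in a Borel set of finite area is Poisson distributed with mean `lam` times the
area, and the numbers of points in pairwise disjoint Borel sets of finite area are independent. -/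
structure IsHomogeneousPPP {Ω : Type*} [MeasurableSpace Ω] (X : ℕ → Ω → Plane) (lam : ℝ)
    (μ : Measure Ω) : Prop where
  measurable : ∀ i, Measurable (X i)
  count_law : ∀ B : Set Plane, MeasurableSet B → volume B ≠ ∞ →
    HasLaw (pointCount X B)
      ((poissonMeasure (Real.toNNReal (lam * volume.real B))).map (Nat.cast : ℕ → ℕ∞)) μ
  count_indep : ∀ (n : ℕ) (B : Fin n → Set Plane), (∀ k, MeasurableSet (B k)) →
    (∀ k, volume (B k) ≠ ∞) → Pairwise (fun k l => Disjoint (B k) (B l)) →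
    iIndepFun (fun k => pointCount X (B k)) μ

/-- The region `⋃_{y ∈ Φ₁} b(y, D)` covered by the holes: open discs of radius `D` around the points
of the process `Y`. -/
def holeRegion {Ω : Type*} (Y : ℕ → Ω → Plane) (D : ℝ) (ω : Ω) : Set Plane :=
  ⋃ y ∈ points Y ω, Metric.ball y D

/-- The Poisson hole process: the points of the baseline process `X` outside all the holes. -/
def holeProcess {Ω : Type*} (X Y : ℕ → Ω → Plane) (D : ℝ) (ω : Ω) : Set Plane :=
  points X ω \ holeRegion Y D ω

/-- The event that a receiver at the origin, seen as an additional point of the baseline process,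
belongs to the hole process, that is, is not covered by a hole. -/
def typicalEvent {Ω : Type*} (Y : ℕ → Ω → Plane) (D : ℝ) : Set Ω :=
  {ω | (0 : Plane) ∉ holeRegion Y D ω}

/-- The interference power `∑_{x ∈ Ψ} P h_x ‖x‖^{-α}` at the origin, as an element of `[0, ∞]`;
`h i` is the fading gain of the link from the `i`-th point of the baseline process. -/
def interference {Ω : Type*} (X Y : ℕ → Ω → Plane) (h : ℕ → Ω → ℝ) (D P α : ℝ) (ω : Ω) : ℝ≥0∞ :=
  ∑' i : {i : ℕ // X i ω ∈ holeProcess X Y D ω},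
    ENNReal.ofReal (P * h i.1 ω * ‖X i.1 ω‖ ^ (-α))

/-- The Laplace transform `s ↦ E[exp(-s I)]`, for `s > 0`, of a `[0, ∞]`-valued random variable `I`
under `ν`, with the usual convention `exp(-∞) = 0`. -/
def laplace {Ω : Type*} [MeasurableSpace Ω] (ν : Measure Ω) (I : Ω → ℝ≥0∞) (s : ℝ) : ℝ :=
  ∫ ω, (if I ω = ∞ then 0 else Real.exp (-(s * (I ω).toReal))) ∂ν

/-- The normalized cardinal sine `sin(πx)/(πx)`. -/
def nsinc (x : ℝ) : ℝ := Real.sinc (Real.pi * x)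

/-- The integrand of the exponent `g(v)`, as a function of `r`. -/
def gIntegrand (lam₂ D P α s v r : ℝ) : ℝ :=
  Real.arccos ((r ^ 2 + v ^ 2 - D ^ 2) / (2 * v * r)) * (2 * lam₂ / (1 + r ^ α / (P * s))) * r

/-- The exponent `g(v) = ∫_{v-D}^{v+D} arccos((r² + v² - D²)/(2vr)) 2λ₂/(1 + r^α/(Ps)) r dr`. -/
def gExponent (lam₂ D P α s v : ℝ) : ℝ :=
  ∫ r in (v - D)..(v + D), gIntegrand lam₂ D P α s v r

/-- The integrand `exp(g(v)) 2πλ₁ v exp(-πλ₁(v² - D²))` of the lower bound. -/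
def boundIntegrand (lam₁ lam₂ D P α s v : ℝ) : ℝ :=
  Real.exp (gExponent lam₂ D P α s v) *
    (2 * Real.pi * lam₁ * v * Real.exp (-(Real.pi * lam₁ * (v ^ 2 - D ^ 2))))

end PoissonHole

end

/-!
The idea is to keep only the hole around the point of `Φ₁` nearest to the origin: removing the other
holes adds interferers, so it can only lower the Laplace transform.

For one fixed hole `b(y, D)` with `‖y‖ > D`, the interference is a shot noise on a Poisson process
with independent exponential gains. Averaging over the gains replaces each weight `c` by
`log (1 + c)` (`lintegral_expNeg_tsum_exp_gains`), and the Laplace functional of the Poisson process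
then yields `exp (-λ₂ ∫ c / (1 + c))`, the integral being over the complement of the hole
(`IsHomogeneousPPP.expNeg_le_lintegral_shotNoise`). The Laplace functional is computed for simple
functions, whose sums are linear combinations of independent Poisson counts, and reaches general
functions by monotone approximation. Here `c / (1 + c) = 1 / (1 + ‖x‖^α / (P s))`. Over the whole
plane this integrates to the `sinc` term, by a Gamma integral and the reflection formula
(`lintegral_plane_gain`); over the hole it integrates to `g(‖y‖) / λ₂`, because in polar coordinates
the circle of radius `r` meets the hole in an arc of half-angle `arccos ((r² + v² - D²) / (2 v r))`
(`lintegral_hole_gain`).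

The bound depends on `y` only through `‖y‖`. So it suffices to know the law of the distance `R` from
the origin to the nearest point of `Φ₁`: it has density `2πλ₁ v exp (-πλ₁ v²)`, by the void
probabilities of discs (`IsHomogeneousPPP.map_nearestDist`), the minimum is almost surely attained,
and the conditioning event is `{R ≥ D}`, of probability `exp (-πλ₁ D²)`. Independence of `Φ₁` from
the baseline process and its gains allows integrating the bound over `R`
(`setLIntegral_nearestDist_le_interference`).

Expectations are Lebesgue integrals of the `[0, 1]`-valued function `expNeg`, which is continuous on
`[0, ∞]`, so that divergent sums need no separate treatment.
-/

namespace PoissonHole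

open Filter Topology

/-! ### Laplace functional of a Poisson process -/

section LaplaceFunctional

/-- The function `t ↦ e^{-t}` on `[0, ∞]`, with `e^{-∞} = 0`. -/
noncomputable def expNeg (t : ℝ≥0∞) : ℝ≥0∞ := EReal.exp (-(t : EReal))

@[simp] lemma expNeg_zero : expNeg 0 = 1 := by simp [expNeg]

@[simp] lemma expNeg_top : expNeg ∞ = 0 := by simp [expNeg]

lemma expNeg_ofReal {x : ℝ} (hx : 0 ≤ x) :
    expNeg (ENNReal.ofReal x) = ENNReal.ofReal (Real.exp (-x)) := by
  rw [expNeg, EReal.coe_ennreal_ofReal, max_eq_left hx, ← EReal.coe_neg, EReal.exp_coe]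

lemma continuous_expNeg : Continuous expNeg :=
  ENNReal.continuous_exp.comp (continuous_neg.comp continuous_coe_ennreal_ereal)

lemma measurable_expNeg : Measurable expNeg := continuous_expNeg.measurable

lemma expNeg_antitone : Antitone expNeg := fun _ _ hab =>
  EReal.exp_monotone (EReal.neg_le_neg_iff.2 (EReal.coe_ennreal_le_coe_ennreal_iff.2 hab))

lemma expNeg_le_one (t : ℝ≥0∞) : expNeg t ≤ 1 :=
  (expNeg_antitone zero_le).trans_eq expNeg_zero

lemma expNeg_add (a b : ℝ≥0∞) : expNeg (a + b) = expNeg a * expNeg b := by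
  rw [expNeg, EReal.coe_ennreal_add, EReal.neg_add (by simp) (by simp), sub_eq_add_neg,
    EReal.exp_add, expNeg, expNeg]

lemma expNeg_sum {ι : Type*} (s : Finset ι) (f : ι → ℝ≥0∞) :
    expNeg (∑ i ∈ s, f i) = ∏ i ∈ s, expNeg (f i) := by
  classical
  induction s using Finset.induction_on with
  | empty => simp
  | insert a s ha ih => rw [Finset.sum_insert ha, Finset.prod_insert ha, expNeg_add, ih]

lemma tendsto_lintegral_expNeg {Ω : Type*} [MeasurableSpace Ω] {μ : Measure Ω} [IsFiniteMeasure μ]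
    {f : ℕ → Ω → ℝ≥0∞} {g : Ω → ℝ≥0∞} (hf : ∀ n, Measurable (f n))
    (hfg : ∀ ω, Tendsto (fun n => f n ω) atTop (𝓝 (g ω))) :
    Tendsto (fun n => ∫⁻ ω, expNeg (f n ω) ∂μ) atTop (𝓝 (∫⁻ ω, expNeg (g ω) ∂μ)) := by
  refine tendsto_lintegral_of_dominated_convergence (fun _ => 1)
    (fun n => measurable_expNeg.comp (hf n))
    (fun n => Eventually.of_forall fun ω => expNeg_le_one _) (by simp)
    (Eventually.of_forall fun ω => (continuous_expNeg.tendsto _).comp (hfg ω))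

/-- The Laplace transform of a Poisson variable. -/
lemma lintegral_expNeg_poisson (r a : ℝ≥0) :
    ∫⁻ n, expNeg (n * a) ∂((poissonMeasure r).map (Nat.cast : ℕ → ℕ∞))
      = expNeg (r * (1 - expNeg a)) := by
  have hexp : ∀ x : ℝ≥0, expNeg x = ENNReal.ofReal (Real.exp (-x)) := fun x => by
    rw [← ENNReal.ofReal_coe_nnreal, expNeg_ofReal x.coe_nonneg]
  have h1 : (r : ℝ≥0∞) * (1 - expNeg a) = ENNReal.ofReal (r * (1 - Real.exp (-a))) := by
    rw [hexp, ENNReal.ofReal_mul (NNReal.coe_nonneg r), ENNReal.ofReal_sub _ (Real.exp_pos _).le]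
    simp
  have h2 : (0 : ℝ) ≤ r * (1 - Real.exp (-a)) :=
    mul_nonneg r.2 (by simp)
  rw [h1, expNeg_ofReal h2, lintegral_map (Measurable.of_discrete) Measurable.of_discrete,
    lintegral_countable']
  have h3 : HasSum (fun n : ℕ => Real.exp (-(r : ℝ)) * ((r * Real.exp (-a)) ^ n / n.factorial))
      (Real.exp (-(r * (1 - Real.exp (-a))))) := by
    have := (NormedSpace.expSeries_div_hasSum_exp (𝔸 := ℝ) (r * Real.exp (-a))).mul_left
      (Real.exp (-(r : ℝ)))
    rw [← Real.exp_eq_exp_ℝ, ← Real.exp_add] at this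
    rwa [show -(r * (1 - Real.exp (-a))) = -(r : ℝ) + r * Real.exp (-a) by ring]
  rw [← h3.tsum_eq, ENNReal.ofReal_tsum_of_nonneg (fun n => by positivity) h3.summable]
  refine tsum_congr fun n => ?_
  have : ((n : ℕ∞) : ℝ≥0∞) * a = ((n * a : ℝ≥0) : ℝ≥0∞) := by simp
  rw [this, hexp, poissonMeasure_singleton, ← ENNReal.ofReal_mul (Real.exp_pos _).le]
  congr 1
  rw [mul_pow, ← Real.exp_nat_mul]
  push_cast
  rw [mul_neg]
  ring

lemma tsum_indicator_const_eq_pointCount {Ω : Type*} (X : ℕ → Ω → Plane) (B : Set Plane)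
    (a : ℝ≥0∞) (ω : Ω) :
    ∑' i, B.indicator (fun _ => a) (X i ω) = pointCount X B ω * a := by
  rw [pointCount, ← ENNReal.tsum_set_const, tsum_subtype {i | X i ω ∈ B} (fun _ => a)]
  rfl

variable {Ω : Type*} [MeasurableSpace Ω] {μ : Measure Ω} {X : ℕ → Ω → Plane} {lam : ℝ}

lemma IsHomogeneousPPP.count_iIndepFun (hX : IsHomogeneousPPP X lam μ) {ι : Type*} [Fintype ι]
    (B : ι → Set Plane) (hB : ∀ k, MeasurableSet (B k)) (hB' : ∀ k, volume (B k) ≠ ∞)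
    (hd : Pairwise fun k l => Disjoint (B k) (B l)) :
    iIndepFun (fun k => pointCount X (B k)) μ := by
  let e := Fintype.equivFin ι
  have := (hX.count_indep _ (fun k => B (e.symm k)) (fun _ => hB _) (fun _ => hB' _)
    (fun k l hkl => hd (e.symm.injective.ne hkl))).precomp e.injective
  simpa [Function.comp_def] using this

lemma IsHomogeneousPPP.lintegral_expNeg_count (hX : IsHomogeneousPPP X lam μ)
    {B : Set Plane} (hB : MeasurableSet B) (hB' : volume B ≠ ∞) (a : ℝ≥0) :
    ∫⁻ ω, expNeg (pointCount X B ω * a) ∂μ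
      = expNeg (ENNReal.ofReal lam * (volume B * (1 - expNeg a))) := by
  have h := hX.count_law B hB hB'
  have h1 := lintegral_expNeg_poisson (Real.toNNReal (lam * volume.real B)) a
  rw [← h.map_eq, lintegral_map' Measurable.of_discrete.aemeasurable h.aemeasurable] at h1
  rw [h1, ← mul_assoc]
  congr 2
  rw [← ENNReal.ofReal_toReal hB', ← ENNReal.ofReal_mul' ENNReal.toReal_nonneg]
  rfl

/-- The Laplace functional of a Poisson process at a simple function truncated to a set of finite
area: the sum over the process is a linear combination of independent Poisson counts. -/
lemma IsHomogeneousPPP.lintegral_expNeg_tsum_simpleFunc (hX : IsHomogeneousPPP X lam μ)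
    {S : Set Plane} (hS : MeasurableSet S) (hS' : volume S ≠ ∞)
    (φ : SimpleFunc Plane ℝ≥0∞) (hφ : ∀ x, φ x < ∞) :
    ∫⁻ ω, expNeg (∑' i, S.indicator φ (X i ω)) ∂μ
      = expNeg (ENNReal.ofReal lam * ∫⁻ x in S, (1 - expNeg (φ x))) := by
  have hfin : ∀ a : φ.range, (a : ℝ≥0∞) ≠ ∞ := by
    rintro ⟨a, ha⟩
    obtain ⟨x, rfl⟩ := SimpleFunc.mem_range.1 ha
    exact (hφ x).ne
  let B : φ.range → Set Plane := fun a => S ∩ φ ⁻¹' {(a : ℝ≥0∞)}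
  have hB : ∀ a, MeasurableSet (B a) := fun a => hS.inter (φ.measurableSet_fiber _)
  have hB' : ∀ a, volume (B a) ≠ ∞ := fun a => measure_ne_top_of_subset Set.inter_subset_left hS'
  have hd : Pairwise fun k l => Disjoint (B k) (B l) := fun k l hkl => by
    refine Set.disjoint_left.2 fun x hk hl => hkl (Subtype.ext ?_)
    exact hk.2.symm.trans hl.2
  have hsum : ∀ (F : ℝ≥0∞ → ℝ≥0∞) x,
      S.indicator (fun x => F (φ x)) x = ∑ a : φ.range, (B a).indicator (fun _ => F a) x := by
    intro F x
    by_cases hx : x ∈ S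
    · rw [Finset.sum_eq_single (⟨φ x, SimpleFunc.mem_range_self φ x⟩ : φ.range)]
      · simp [B, hx]
      · intro b _ hb
        refine Set.indicator_of_notMem (fun h => hb (Subtype.ext h.2.symm)) _
      · simp
    · rw [Set.indicator_of_notMem hx, Finset.sum_eq_zero]
      exact fun a _ => Set.indicator_of_notMem (fun h => hx h.1) _
  have h1 : ∀ ω, expNeg (∑' i, S.indicator φ (X i ω))
      = ∏ a : φ.range, expNeg (pointCount X (B a) ω * a) := by
    intro ω
    rw [← expNeg_sum]
    congr 1
    simp_rw [← tsum_indicator_const_eq_pointCount]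
    rw [← Summable.tsum_finsetSum fun _ _ => ENNReal.summable]
    exact tsum_congr fun i => hsum id _
  have hind := (hX.count_iIndepFun B hB hB' hd).comp
    (fun a (n : ℕ∞) => expNeg ((n : ℝ≥0∞) * a)) (fun _ => Measurable.of_discrete)
  have hmeas : ∀ a : φ.range, Measurable (fun ω => expNeg (pointCount X (B a) ω * a)) := by
    intro a
    simp_rw [← tsum_indicator_const_eq_pointCount]
    exact measurable_expNeg.comp (Measurable.tsum fun i =>
      ((measurable_const.indicator (hB a)).comp (hX.measurable i)))
  simp_rw [h1]
  rw [lintegral_prod_eq_prod_lintegral_of_indepFun Finset.univ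
    (fun (a : φ.range) ω => expNeg (pointCount X (B a) ω * a)) hind hmeas]
  have h2 : ∀ a : φ.range, ∫⁻ ω, expNeg (pointCount X (B a) ω * a) ∂μ
      = expNeg (ENNReal.ofReal lam * (volume (B a) * (1 - expNeg a))) := by
    intro a
    have := hX.lintegral_expNeg_count (hB a) (hB' a) (a : ℝ≥0∞).toNNReal
    rwa [ENNReal.coe_toNNReal (hfin a)] at this
  simp_rw [h2]
  rw [← expNeg_sum, ← Finset.mul_sum, ← lintegral_indicator hS]
  simp_rw [hsum (fun t => 1 - expNeg t)]
  rw [lintegral_finsetSum _ fun a _ => measurable_const.indicator (hB a)]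
  simp_rw [lintegral_indicator (hB _), setLIntegral_const, mul_comm (volume _)]

/-- The lower bound in the formula for the Laplace functional of a Poisson process. -/
theorem IsHomogeneousPPP.expNeg_le_lintegral_expNeg_tsum [IsFiniteMeasure μ]
    (hX : IsHomogeneousPPP X lam μ) {φ : Plane → ℝ≥0∞} (hφ : Measurable φ) :
    expNeg (ENNReal.ofReal lam * ∫⁻ x, (1 - expNeg (φ x)))
      ≤ ∫⁻ ω, expNeg (∑' i, φ (X i ω)) ∂μ := by
  let S : ℕ → Set Plane := fun n => Metric.ball 0 n
  let ψ : ℕ → Plane → ℝ≥0∞ := fun n => (S n).indicator (SimpleFunc.eapprox φ n)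
  have hψm : ∀ n, Measurable (ψ n) := fun n =>
    (SimpleFunc.measurable _).indicator Metric.isOpen_ball.measurableSet
  have hψmono : Monotone ψ := fun m n hmn x => by
    have hS : S m ⊆ S n := Metric.ball_subset_ball (Nat.cast_le.2 hmn)
    exact (Set.indicator_le_indicator_of_subset hS (fun _ => zero_le) x).trans
      (Set.indicator_le_indicator (SimpleFunc.monotone_eapprox φ hmn x))
  have hψlim : ∀ x, Tendsto (fun n => ψ n x) atTop (𝓝 (φ x)) := fun x => by
    refine (SimpleFunc.tendsto_eapprox hφ x).congr' ?_
    obtain ⟨N, hN⟩ := exists_nat_gt ‖x‖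
    filter_upwards [eventually_ge_atTop N] with n hn
    refine (Set.indicator_of_mem ?_ _).symm
    simpa [S] using hN.trans_le (by exact_mod_cast hn)
  have hle : ∀ n x, SimpleFunc.eapprox φ n x ≤ φ x := fun n x =>
    Monotone.ge_of_tendsto (fun _ _ h => SimpleFunc.monotone_eapprox φ h x)
      (SimpleFunc.tendsto_eapprox hφ x) n
  have hlim : ∀ ω, Tendsto (fun n => ∑' i, ψ n (X i ω)) atTop (𝓝 (∑' i, φ (X i ω))) := fun ω => by
    simp_rw [← lintegral_count]
    exact lintegral_tendsto_of_tendsto_of_monotone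
      (fun n => (Measurable.of_discrete).aemeasurable)
      (Eventually.of_forall fun i _ _ h => hψmono h _) (Eventually.of_forall fun i => hψlim _)
  have hm : ∀ n, Measurable fun ω => ∑' i, ψ n (X i ω) := fun n =>
    Measurable.tsum fun i => (hψm n).comp (hX.measurable i)
  refine ge_of_tendsto' (tendsto_lintegral_expNeg (μ := μ) hm hlim) fun n => ?_
  rw [hX.lintegral_expNeg_tsum_simpleFunc Metric.isOpen_ball.measurableSet
    measure_ball_lt_top.ne _ (fun x => SimpleFunc.eapprox_lt_top φ n x)]
  refine expNeg_antitone (mul_le_mul_right ?_ _)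
  exact (setLIntegral_le_lintegral _ _).trans (lintegral_mono fun x =>
    tsub_le_tsub_left (expNeg_antitone (hle n x)) _)

end LaplaceFunctional

/-! ### Shot noise with exponential gains -/

section ShotNoise

variable {Ω : Type*} [MeasurableSpace Ω] {μ : Measure Ω} {X : ℕ → Ω → Plane} {h : ℕ → Ω → ℝ}
  {lam : ℝ}

/-- For independent `U` and `V`, expectations of functions of `(U, V)` are iterated expectations. -/
lemma lintegral_comp_prodMk_of_indepFun [IsFiniteMeasure μ] {β γ : Type*} [MeasurableSpace β]
    [MeasurableSpace γ] {U : Ω → β} {V : Ω → γ} (hU : Measurable U) (hV : Measurable V)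
    (hUV : IndepFun U V μ) {F : β × γ → ℝ≥0∞} (hF : Measurable F) :
    ∫⁻ ω, F (U ω, V ω) ∂μ = ∫⁻ ω, ∫⁻ ω', F (U ω, V ω') ∂μ ∂μ := by
  rw [← lintegral_map hF (hU.prodMk hV),
    (indepFun_iff_map_prod_eq_prod_map_map hU.aemeasurable hV.aemeasurable).1 hUV,
    lintegral_prod _ hF.aemeasurable, lintegral_map hF.lintegral_prod_right' hU]
  exact lintegral_congr fun ω => lintegral_map (hF.comp measurable_prodMk_left) hV

lemma measurable_expNeg_mul (c : ℝ) : Measurable fun x : ℝ => expNeg (ENNReal.ofReal (c * x)) :=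
  measurable_expNeg.comp (by fun_prop)

/-- The Laplace transform of an exponential variable, in a form adapted to independent products. -/
lemma lintegral_expNeg_expMeasure {c : ℝ} (hc : 0 ≤ c) :
    ∫⁻ x, expNeg (ENNReal.ofReal (c * x)) ∂(expMeasure 1)
      = expNeg (ENNReal.ofReal (Real.log (1 + c))) := by
  have hc1 : 0 < 1 + c := by linarith
  have hpdf : expMeasure 1 = volume.withDensity (exponentialPDF 1) := rfl
  have hm : Measurable (exponentialPDF 1) := (measurable_exponentialPDFReal 1).ennreal_ofReal
  rw [hpdf, lintegral_withDensity_eq_lintegral_mul _ hm (measurable_expNeg_mul c)]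
  have h1 : ∀ x : ℝ, (exponentialPDF 1 * fun x => expNeg (ENNReal.ofReal (c * x))) x
      = ENNReal.ofReal (1 / (1 + c)) * exponentialPDF (1 + c) x := by
    intro x
    rcases lt_or_ge x 0 with hx | hx
    · simp [exponentialPDF_of_neg hx]
    · rw [Pi.mul_apply, exponentialPDF_of_nonneg hx, exponentialPDF_of_nonneg hx,
        expNeg_ofReal (mul_nonneg hc hx), ← ENNReal.ofReal_mul (by positivity),
        ← ENNReal.ofReal_mul (by positivity)]
      congr 1
      rw [mul_assoc, ← Real.exp_add]
      field_simp
      ring_nf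
  simp_rw [h1]
  have hm' : Measurable (exponentialPDF (1 + c)) :=
    (measurable_exponentialPDFReal (1 + c)).ennreal_ofReal
  rw [lintegral_const_mul _ hm', lintegral_exponentialPDF_eq_one hc1, mul_one,
    expNeg_ofReal (Real.log_nonneg (by linarith)), Real.exp_neg, Real.exp_log hc1, one_div]

/-- Averaging over independent unit-mean exponential gains: each weight `c i` is replaced by
`log (1 + c i)`. -/
lemma lintegral_expNeg_tsum_exp_gains (hm : ∀ i, Measurable (h i))
    (hh : ∀ i, HasLaw (h i) (expMeasure 1) μ) (hind : iIndepFun h μ) {c : ℕ → ℝ}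
    (hc : ∀ i, 0 ≤ c i) :
    ∫⁻ ω, expNeg (∑' i, ENNReal.ofReal (c i * h i ω)) ∂μ
      = expNeg (∑' i, ENNReal.ofReal (Real.log (1 + c i))) := by
  have := hind.isProbabilityMeasure
  have hmi : ∀ i, Measurable fun ω => ENNReal.ofReal (c i * h i ω) := fun i =>
    (measurable_const.mul (hm i)).ennreal_ofReal
  have hfin : ∀ n, ∫⁻ ω, expNeg (∑ i ∈ Finset.range n, ENNReal.ofReal (c i * h i ω)) ∂μ
      = expNeg (∑ i ∈ Finset.range n, ENNReal.ofReal (Real.log (1 + c i))) := by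
    intro n
    simp_rw [expNeg_sum]
    have hind' := hind.comp (fun i x => expNeg (ENNReal.ofReal (c i * x))) (fun i =>
      measurable_expNeg_mul (c i))
    rw [lintegral_prod_eq_prod_lintegral_of_indepFun (Finset.range n)
      (fun i ω => expNeg (ENNReal.ofReal (c i * h i ω))) hind'
      (fun i => measurable_expNeg.comp (hmi i))]
    refine Finset.prod_congr rfl fun i _ => ?_
    rw [← lintegral_expNeg_expMeasure (hc i), ← (hh i).map_eq, lintegral_map
      (measurable_expNeg_mul (c i)) (hm i)]
  refine tendsto_nhds_unique (tendsto_lintegral_expNeg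
    (fun n => Finset.measurable_fun_sum _ fun i _ => hmi i)
    (fun ω =>
      (ENNReal.summable (f := fun i => ENNReal.ofReal (c i * h i ω))).hasSum.tendsto_sum_nat))
    ?_
  simp_rw [hfin]
  exact (continuous_expNeg.tendsto _).comp ENNReal.summable.hasSum.tendsto_sum_nat

lemma one_sub_expNeg_log {c : ℝ} (hc : 0 ≤ c) :
    1 - expNeg (ENNReal.ofReal (Real.log (1 + c))) = ENNReal.ofReal (c / (1 + c)) := by
  have hc1 : 0 < 1 + c := by linarith
  rw [expNeg_ofReal (Real.log_nonneg (by linarith)), Real.exp_neg, Real.exp_log hc1,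
    ← ENNReal.ofReal_one, ← ENNReal.ofReal_sub _ (by positivity)]
  congr 1
  field_simp
  ring

/-- Shot noise with independent exponential gains on a Poisson process: the lower bound in the
formula for its Laplace transform. -/
theorem IsHomogeneousPPP.expNeg_le_lintegral_shotNoise [IsProbabilityMeasure μ]
    (hX : IsHomogeneousPPP X lam μ) (hm : ∀ i, Measurable (h i))
    (hh : ∀ i, HasLaw (h i) (expMeasure 1) μ)
    (hind : iIndepFun h μ) (hXh : IndepFun (fun ω i => X i ω) (fun ω i => h i ω) μ)
    {c : Plane → ℝ} (hc : ∀ x, 0 ≤ c x) (hcm : Measurable c) :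
    expNeg (ENNReal.ofReal lam * ∫⁻ x, ENNReal.ofReal (c x / (1 + c x)))
      ≤ ∫⁻ ω, expNeg (∑' i, ENNReal.ofReal (c (X i ω) * h i ω)) ∂μ := by
  have hXm : Measurable fun ω i => X i ω := measurable_pi_lambda _ hX.measurable
  have hhm : Measurable fun ω i => h i ω := measurable_pi_lambda _ hm
  let F : (ℕ → Plane) × (ℕ → ℝ) → ℝ≥0∞ :=
    fun p => expNeg (∑' i, ENNReal.ofReal (c (p.1 i) * p.2 i))
  have hF : Measurable F := measurable_expNeg.comp (Measurable.tsum fun i => by fun_prop)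
  have h1 : ∫⁻ ω, expNeg (∑' i, ENNReal.ofReal (c (X i ω) * h i ω)) ∂μ
      = ∫⁻ ω, expNeg (∑' i, ENNReal.ofReal (Real.log (1 + c (X i ω)))) ∂μ :=
    (lintegral_comp_prodMk_of_indepFun hXm hhm hXh hF).trans
      (lintegral_congr fun ω => lintegral_expNeg_tsum_exp_gains hm hh hind fun i => hc (X i ω))
  rw [h1]
  have h2 := hX.expNeg_le_lintegral_expNeg_tsum
    (φ := fun x => ENNReal.ofReal (Real.log (1 + c x))) (by fun_prop)
  simpa only [one_sub_expNeg_log (hc _)] using h2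

end ShotNoise

/-! ### Integrals over the plane and over a hole -/

/-- A nonzero Bochner integral certifies integrability, so its value passes to the Lebesgue
integral. -/
lemma setLIntegral_ofReal_of_integral_eq {S : Set ℝ} (hS : MeasurableSet S) {f : ℝ → ℝ} {a : ℝ}
    (hf : ∀ x ∈ S, 0 ≤ f x) (ha : 0 < a) (h : ∫ x in S, f x = a) :
    ∫⁻ x in S, ENNReal.ofReal (f x) = ENNReal.ofReal a := by
  have hi : IntegrableOn f S := by
    by_contra hi
    exact ha.ne' (h ▸ integral_undef hi)
  rw [← h, ofReal_integral_eq_lintegral_ofReal hi (ae_restrict_of_forall_mem hS hf)]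

lemma continuous_mk_plane : Continuous fun p : ℝ × ℝ => (!₂[p.1, p.2] : Plane) := by
  refine (PiLp.continuous_toLp 2 _).comp (continuous_pi fun i => ?_)
  fin_cases i
  · exact continuous_fst
  · exact continuous_snd

/-- Integration over the Euclidean plane in polar coordinates. -/
lemma lintegral_plane_polar {F : Plane → ℝ≥0∞} (hF : Measurable F) :
    ∫⁻ x, F x = ∫⁻ r in Set.Ioi (0 : ℝ), ∫⁻ θ in Set.Ioo (-Real.pi) Real.pi,
      ENNReal.ofReal r * F !₂[r * Real.cos θ, r * Real.sin θ] := by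
  have h1 := ((EuclideanSpace.volume_preserving_symm_measurableEquiv_toLp (Fin 2)).symm _).comp
    (volume_preserving_finTwoArrow ℝ).symm
  have hG : Measurable fun p : ℝ × ℝ => F !₂[p.1, p.2] := hF.comp continuous_mk_plane.measurable
  have hpol : Measurable fun p : ℝ × ℝ => (p.1 * Real.cos p.2, p.1 * Real.sin p.2) := by fun_prop
  have h2 : ∫⁻ x, F x = ∫⁻ p : ℝ × ℝ, F !₂[p.1, p.2] := by
    rw [← h1.lintegral_comp hF]
    rfl
  rw [h2, ← lintegral_comp_polarCoord_symm, polarCoord_target, Measure.volume_eq_prod,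
    ← Measure.prod_restrict, lintegral_prod]
  · rfl
  · exact (measurable_fst.ennreal_ofReal.mul (hG.comp hpol)).aemeasurable

/-- The integral `∫₀^∞ r / (1 + r^α / c) dr`, by writing the denominator as a Gamma integral,
exchanging the integrations and using the reflection formula. -/
lemma lintegral_radial {α c : ℝ} (hα : 2 < α) (hc : 0 < c) :
    ∫⁻ r in Set.Ioi (0 : ℝ), ENNReal.ofReal (r * (1 / (1 + r ^ α / c)))
      = ENNReal.ofReal (c ^ (2 / α) * (1 / α) * (Real.pi / Real.sin (Real.pi * (2 / α)))) := by
  have hα0 : 0 < α := by linarith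
  have h2α : 0 < 2 / α := by positivity
  have h2α1 : 0 < 1 - 2 / α := by rw [sub_pos, div_lt_one hα0]; exact hα
  have hΓ := Real.Gamma_pos_of_pos h2α
  have hΓ' := Real.Gamma_pos_of_pos h2α1
  have h1 : ∀ r ∈ Set.Ioi (0 : ℝ), ENNReal.ofReal (r * (1 / (1 + r ^ α / c)))
      = ∫⁻ t in Set.Ioi (0 : ℝ), ENNReal.ofReal (r * Real.exp (-((1 + r ^ α / c) * t))) := by
    intro r (hr : 0 < r)
    have hb : 0 < 1 + r ^ α / c := by positivity
    refine (setLIntegral_ofReal_of_integral_eq measurableSet_Ioi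
      (fun t _ => by positivity) (by positivity) ?_).symm
    rw [integral_const_mul]
    have := Real.integral_rpow_mul_exp_neg_mul_Ioi one_pos hb
    simp only [sub_self, Real.rpow_zero, one_mul, Real.rpow_one, Real.Gamma_one, mul_one] at this
    rw [this]
  have h2 : ∀ t ∈ Set.Ioi (0 : ℝ),
      ∫⁻ r in Set.Ioi (0 : ℝ), ENNReal.ofReal (r * Real.exp (-((1 + r ^ α / c) * t)))
      = ENNReal.ofReal (c ^ (2 / α) * (1 / α) * Real.Gamma (2 / α) *
          (t ^ ((1 - 2 / α) - 1) * Real.exp (-(1 * t)))) := by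
    intro t (ht : 0 < t)
    have := integral_rpow_mul_exp_neg_mul_rpow hα0 (q := 1) (by norm_num) (div_pos ht hc)
    refine setLIntegral_ofReal_of_integral_eq measurableSet_Ioi
      (fun r (hr : 0 < r) => by positivity) (by positivity) ?_
    calc _ = ∫ r in Set.Ioi (0 : ℝ),
          Real.exp (-t) * (r ^ (1 : ℝ) * Real.exp (-(t / c) * r ^ α)) := by
          congr 1 with r
          rw [Real.rpow_one, mul_left_comm, ← Real.exp_add]
          congr 2
          ring
      _ = _ := by
          rw [integral_const_mul, this, show (1 : ℝ) + 1 = 2 by norm_num, Real.div_rpow ht.le hc.le,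
            neg_div, Real.rpow_neg hc.le, show 1 - 2 / α - 1 = -(2 / α) by ring]
          rw [div_inv_eq_mul]
          ring_nf
  rw [setLIntegral_congr_fun measurableSet_Ioi h1, lintegral_lintegral_swap (by fun_prop),
    setLIntegral_congr_fun measurableSet_Ioi h2]
  rw [← Real.Gamma_mul_Gamma_one_sub]
  refine setLIntegral_ofReal_of_integral_eq measurableSet_Ioi
      (fun r (hr : 0 < r) => by positivity) (by positivity) ?_
  rw [integral_const_mul, Real.integral_rpow_mul_exp_neg_mul_Ioi h2α1 one_pos]
  simp
  ring

lemma norm_polar {r : ℝ} (hr : 0 < r) (θ : ℝ) :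
    ‖(!₂[r * Real.cos θ, r * Real.sin θ] : Plane)‖ = r := by
  rw [EuclideanSpace.norm_eq, Real.sqrt_eq_iff_eq_sq (by positivity) hr.le]
  simp only [Fin.sum_univ_two, Real.norm_eq_abs, sq_abs]
  simp
  linear_combination r ^ 2 * Real.sin_sq_add_cos_sq θ

/-- The total mass of `x ↦ 1 / (1 + ‖x‖^α / (P s))` over the plane. -/
lemma lintegral_plane_gain {P α s : ℝ} (hP : 0 < P) (hα : 2 < α) (hs : 0 < s) :
    ∫⁻ x : Plane, ENNReal.ofReal (1 / (1 + ‖x‖ ^ α / (P * s)))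
      = ENNReal.ofReal (Real.pi * ((s * P) ^ (2 / α) / nsinc (2 / α))) := by
  have hα0 : 0 < α := by linarith
  rw [lintegral_plane_polar (by fun_prop)]
  have h1 : ∀ r ∈ Set.Ioi (0 : ℝ), ∫⁻ θ in Set.Ioo (-Real.pi) Real.pi, ENNReal.ofReal r *
      ENNReal.ofReal (1 / (1 + ‖(!₂[r * Real.cos θ, r * Real.sin θ] : Plane)‖ ^ α / (P * s)))
      = ENNReal.ofReal (2 * Real.pi) * ENNReal.ofReal (r * (1 / (1 + r ^ α / (P * s)))) := by
    intro r (hr : 0 < r)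
    simp_rw [norm_polar hr]
    rw [setLIntegral_const, Real.volume_Ioo, mul_comm, ENNReal.ofReal_mul hr.le]
    ring_nf
  rw [setLIntegral_congr_fun measurableSet_Ioi h1, lintegral_const_mul' _ _ ENNReal.ofReal_ne_top,
    lintegral_radial hα (by positivity), ← ENNReal.ofReal_mul (by positivity)]
  have : Real.pi * (2 / α) ≠ 0 := by positivity
  rw [nsinc, Real.sinc_of_ne_zero this, mul_comm P s]
  congr 1
  rcases eq_or_ne (Real.sin (Real.pi * (2 / α))) 0 with h0 | h0
  · simp [h0]
  · field_simp

lemma intervalIntegrable_gIntegrand {lam₂ D P α s v : ℝ} (hD : 0 < D) (hP : 0 < P)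
    (hα : 2 < α) (hs : 0 < s) (hv : D < v) :
    IntervalIntegrable (gIntegrand lam₂ D P α s v) volume (v - D) (v + D) := by
  refine ContinuousOn.intervalIntegrable ?_
  rw [Set.uIcc_of_le (by linarith)]
  have hpos : ∀ r ∈ Set.Icc (v - D) (v + D), 0 < r := fun r hr => by linarith [hr.1]
  unfold gIntegrand
  have hr : ContinuousOn (fun r : ℝ => r ^ α) (Set.Icc (v - D) (v + D)) :=
    (Real.continuous_rpow_const (by linarith)).continuousOn
  refine ((Real.continuous_arccos.comp_continuousOn ?_).mul ?_).mul continuousOn_id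
  · refine ContinuousOn.div (by fun_prop) (by fun_prop) fun r hr => ?_
    have := hpos r hr
    have : 0 < v := by linarith
    positivity
  · refine ContinuousOn.div (by fun_prop) (by fun_prop) fun r hr => ?_
    have := hpos r hr
    positivity

lemma cos_gt_iff {c θ : ℝ} (hc : -1 ≤ c) (hθ : θ ∈ Set.Ioo (-Real.pi) Real.pi) :
    c < Real.cos θ ↔ |θ| < Real.arccos c := by
  have habs : Real.arccos (Real.cos θ) = |θ| := by
    rw [← Real.cos_abs, Real.arccos_cos (abs_nonneg _) (abs_lt.2 hθ).le]
  constructor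
  · intro h
    rw [← habs]
    exact Real.strictAntiOn_arccos ⟨hc, h.le.trans (Real.cos_le_one _)⟩
      ⟨Real.neg_one_le_cos _, Real.cos_le_one _⟩ h
  · contrapose!
    intro h
    exact (Real.antitone_arccos h).trans_eq habs

/-- The circle of radius `r` around the origin meets the disc `b((v, 0), D)` in an arc of half-angle
`arccos ((r² + v² - D²) / (2 v r))`. -/
lemma volume_arc {D v r : ℝ} (hD : 0 < D) (hv : D < v) (hr : 0 < r) :
    volume ({θ | !₂[r * Real.cos θ, r * Real.sin θ] ∈
        Metric.ball (EuclideanSpace.single (0 : Fin 2) v) D} ∩ Set.Ioo (-Real.pi) Real.pi)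
      = ENNReal.ofReal (2 * Real.arccos ((r ^ 2 + v ^ 2 - D ^ 2) / (2 * v * r))) := by
  have hv0 : 0 < v := hD.trans hv
  set c := (r ^ 2 + v ^ 2 - D ^ 2) / (2 * v * r)
  have hc : -1 ≤ c := le_trans (by norm_num) (div_nonneg (by nlinarith) (by positivity) : 0 ≤ c)
  have hset : {θ | !₂[r * Real.cos θ, r * Real.sin θ] ∈
        Metric.ball (EuclideanSpace.single (0 : Fin 2) v) D} ∩ Set.Ioo (-Real.pi) Real.pi
      = Set.Ioo (-Real.arccos c) (Real.arccos c) := by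
    ext θ
    have hball : !₂[r * Real.cos θ, r * Real.sin θ] ∈
        Metric.ball (EuclideanSpace.single (0 : Fin 2) v) D ↔ c < Real.cos θ := by
      rw [Metric.mem_ball, EuclideanSpace.dist_eq, Real.sqrt_lt' hD, div_lt_iff₀ (by positivity)]
      simp only [Fin.sum_univ_two, Real.dist_eq, sq_abs]
      simp
      have := Real.sin_sq_add_cos_sq θ
      constructor <;> intro h <;> nlinarith
    rw [Set.mem_inter_iff, Set.mem_ofPred_eq, hball, Set.mem_Ioo (a := -Real.arccos c), ← abs_lt]
    constructor
    · rintro ⟨h, hθ⟩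
      exact (cos_gt_iff hc hθ).1 h
    · intro h
      have hθ : θ ∈ Set.Ioo (-Real.pi) Real.pi := abs_lt.1 (h.trans_le (Real.arccos_le_pi c))
      exact ⟨(cos_gt_iff hc hθ).2 h, hθ⟩
  rw [hset, Real.volume_Ioo]
  ring_nf

lemma gIntegrand_nonneg {lam₂ D P α s v r : ℝ} (hlam₂ : 0 < lam₂) (hP : 0 < P) (hs : 0 < s)
    (hr : 0 < r) : 0 ≤ gIntegrand lam₂ D P α s v r := by
  have := Real.arccos_nonneg ((r ^ 2 + v ^ 2 - D ^ 2) / (2 * v * r))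
  unfold gIntegrand
  positivity

/-- The mass that a hole centred at distance `v > D` from the origin removes is `g(v)`. -/
lemma lintegral_hole_gain {lam₂ D P α s : ℝ} (hlam₂ : 0 < lam₂) (hD : 0 < D) (hP : 0 < P)
    (hα : 2 < α) (hs : 0 < s) {y : Plane} (hy : D < ‖y‖) :
    ENNReal.ofReal lam₂ * ∫⁻ x in Metric.ball y D, ENNReal.ofReal (1 / (1 + ‖x‖ ^ α / (P * s)))
      = ENNReal.ofReal (gExponent lam₂ D P α s ‖y‖) := by
  set v := ‖y‖
  have hv0 : 0 < v := hD.trans hy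
  -- A reflection moves the centre of the hole to the first coordinate axis.
  set y' : Plane := EuclideanSpace.single (0 : Fin 2) v
  have hyy' : ‖y‖ = ‖y'‖ := by simp [y', v]
  let e : Plane ≃ₗᵢ[ℝ] Plane := (ℝ ∙ (y - y'))ᗮ.reflection
  have hey : e y = y' := Submodule.reflection_sub hyy'
  let F : Plane → ℝ≥0∞ := (Metric.ball y' D).indicator fun x =>
    ENNReal.ofReal (1 / (1 + ‖x‖ ^ α / (P * s)))
  have hF : Measurable F := Measurable.indicator (by fun_prop) Metric.isOpen_ball.measurableSet
  have h1 : ∫⁻ x in Metric.ball y D, ENNReal.ofReal (1 / (1 + ‖x‖ ^ α / (P * s)))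
      = ∫⁻ x, F x := by
    rw [← lintegral_indicator Metric.isOpen_ball.measurableSet,
      ← e.measurePreserving.lintegral_comp hF]
    refine lintegral_congr fun x => ?_
    classical
    simp only [F, Set.indicator_apply, Metric.mem_ball, ← hey, e.dist_map, e.norm_map]
  have h2 : ∀ r ∈ Set.Ioi (0 : ℝ), ∫⁻ θ in Set.Ioo (-Real.pi) Real.pi,
      ENNReal.ofReal r * F !₂[r * Real.cos θ, r * Real.sin θ]
      = ENNReal.ofReal (1 / lam₂ * gIntegrand lam₂ D P α s v r) := by
    intro r (hr : 0 < r)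
    have hm : MeasurableSet {θ : ℝ | !₂[r * Real.cos θ, r * Real.sin θ] ∈ Metric.ball y' D} :=
      (Metric.isOpen_ball.preimage (continuous_mk_plane.comp (by fun_prop :
        Continuous fun θ : ℝ => (r * Real.cos θ, r * Real.sin θ)))).measurableSet
    have h3 : ∀ θ, ENNReal.ofReal r * F !₂[r * Real.cos θ, r * Real.sin θ]
        = {θ : ℝ | !₂[r * Real.cos θ, r * Real.sin θ] ∈ Metric.ball y' D}.indicator
          (fun _ => ENNReal.ofReal r * ENNReal.ofReal (1 / (1 + r ^ α / (P * s)))) θ := by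
      intro θ
      classical
      simp only [F, Set.indicator_apply, Set.mem_ofPred_eq, norm_polar hr, mul_ite, mul_zero]
    have := Real.arccos_nonneg ((r ^ 2 + v ^ 2 - D ^ 2) / (2 * v * r))
    simp_rw [h3]
    rw [lintegral_indicator_const hm, Measure.restrict_apply hm, volume_arc hD hy hr,
      ← ENNReal.ofReal_mul hr.le, ← ENNReal.ofReal_mul (by positivity), gIntegrand]
    congr 1
    field_simp
  -- Circles of radius outside `(v - D, v + D]` miss the hole, and there the `arccos` vanishes.
  have h4 : ∫⁻ r in Set.Ioi (0 : ℝ), ENNReal.ofReal (gIntegrand lam₂ D P α s v r)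
      = ∫⁻ r in Set.Ioc (v - D) (v + D), ENNReal.ofReal (gIntegrand lam₂ D P α s v r) := by
    rw [← lintegral_indicator measurableSet_Ioi, ← lintegral_indicator measurableSet_Ioc]
    refine lintegral_congr fun r => ?_
    by_cases hr : r ∈ Set.Ioc (v - D) (v + D)
    · have hr0 : 0 < r := by linarith [hr.1]
      rw [Set.indicator_of_mem hr, Set.indicator_of_mem (Set.mem_Ioi.2 hr0)]
    · rw [Set.indicator_of_notMem hr, Set.indicator_apply_eq_zero]
      intro (hr0 : 0 < r)
      have hc : 1 ≤ (r ^ 2 + v ^ 2 - D ^ 2) / (2 * v * r) := by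
        rw [le_div_iff₀ (by positivity)]
        rw [Set.mem_Ioc, not_and_or, not_lt, not_le] at hr
        rcases hr with hr | hr <;> nlinarith
      simp [gIntegrand, Real.arccos_eq_zero.2 hc]
  have hint := intervalIntegrable_gIntegrand (lam₂ := lam₂) hD hP hα hs hy
  rw [intervalIntegrable_iff_integrableOn_Ioc_of_le (by linarith)] at hint
  rw [h1, lintegral_plane_polar hF, setLIntegral_congr_fun measurableSet_Ioi h2]
  simp_rw [ENNReal.ofReal_mul (one_div_pos.2 hlam₂).le]
  rw [lintegral_const_mul' _ _ (by simp), ← mul_assoc, ← ENNReal.ofReal_mul hlam₂.le,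
    mul_one_div_cancel hlam₂.ne', ENNReal.ofReal_one, one_mul, h4, gExponent,
    intervalIntegral.integral_of_le (by linarith), ofReal_integral_eq_lintegral_ofReal hint]
  exact ae_restrict_of_forall_mem measurableSet_Ioc fun r hr =>
    gIntegrand_nonneg hlam₂ hP hs (by linarith [hr.1])

/-! ### Distance to the nearest point of a Poisson process -/

section NearestPoint

/-- The distance from the origin to the nearest point of a configuration, as an infimum; it is
attained for locally finite configurations. -/
noncomputable def nearestDist (y : ℕ → Plane) : ℝ := ⨅ i, ‖y i‖

lemma bddBelow_norm (y : ℕ → Plane) : BddBelow (Set.range fun i => ‖y i‖) :=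
  ⟨0, by rintro _ ⟨i, rfl⟩; exact norm_nonneg _⟩

lemma le_nearestDist_iff {y : ℕ → Plane} {r : ℝ} : r ≤ nearestDist y ↔ ∀ i, r ≤ ‖y i‖ :=
  le_ciInf_iff (bddBelow_norm y)

lemma measurable_nearestDist : Measurable nearestDist := by
  refine measurable_of_Ici fun r => ?_
  have : nearestDist ⁻¹' Set.Ici r = ⋂ i, {y | r ≤ ‖y i‖} := by
    ext y
    simp [le_nearestDist_iff]
  rw [this]
  exact MeasurableSet.iInter fun i => measurableSet_le (by fun_prop) (by fun_prop)

lemma typicalEvent_eq {Ω : Type*} (Y : ℕ → Ω → Plane) (D : ℝ) :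
    typicalEvent Y D = {ω | D ≤ nearestDist fun i => Y i ω} := by
  ext ω
  simp [typicalEvent, holeRegion, points, le_nearestDist_iff]

variable {Ω : Type*} [MeasurableSpace Ω] {μ : Measure Ω} {Y : ℕ → Ω → Plane} {lam D : ℝ}

lemma IsHomogeneousPPP.measurable_nearestDist (hY : IsHomogeneousPPP Y lam μ) :
    Measurable fun ω => nearestDist fun i => Y i ω :=
  PoissonHole.measurable_nearestDist.comp (measurable_pi_lambda _ hY.measurable)

/-- The void probability of a disc around the origin. -/
lemma IsHomogeneousPPP.measure_le_nearestDist (hY : IsHomogeneousPPP Y lam μ) (hlam : 0 < lam)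
    {r : ℝ} (hr : 0 ≤ r) :
    μ {ω | r ≤ nearestDist fun i => Y i ω}
      = ENNReal.ofReal (Real.exp (-(Real.pi * lam * r ^ 2))) := by
  have hl := hY.count_law (Metric.ball 0 r) Metric.isOpen_ball.measurableSet
    measure_ball_lt_top.ne
  have hset : {ω | r ≤ nearestDist fun i => Y i ω} = pointCount Y (Metric.ball 0 r) ⁻¹' {0} := by
    ext ω
    simp [pointCount, le_nearestDist_iff, Set.eq_empty_iff_forall_notMem]
  have h0 : (Nat.cast : ℕ → ℕ∞) ⁻¹' {0} = {0} := by ext n; simp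
  rw [hset, ← Measure.map_apply_of_aemeasurable hl.aemeasurable (MeasurableSet.of_discrete),
    hl.map_eq, Measure.map_apply Measurable.of_discrete MeasurableSet.of_discrete, h0,
    poissonMeasure_singleton]
  have hvol : volume.real (Metric.ball (0 : Plane) r) = Real.pi * r ^ 2 := by
    rw [measureReal_def, EuclideanSpace.volume_ball_fin_two]
    simp [hr, Real.pi_pos.le, mul_comm]
  rw [hvol, Real.coe_toNNReal _ (by positivity)]
  simp
  ring_nf

/-- A Poisson process almost surely has a point nearest to the origin, being locally finite. -/
lemma IsHomogeneousPPP.exists_norm_eq_nearestDist (hY : IsHomogeneousPPP Y lam μ) :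
    ∀ᵐ ω ∂μ, ∃ i, ‖Y i ω‖ = nearestDist fun i => Y i ω := by
  have hfin : ∀ᵐ ω ∂μ, ∀ n : ℕ, pointCount Y (Metric.ball 0 n) ω < ⊤ := by
    refine ae_all_iff.2 fun n => ?_
    have hl := hY.count_law (Metric.ball 0 n) Metric.isOpen_ball.measurableSet
      measure_ball_lt_top.ne
    rw [hl.ae_iff (p := fun k => k < ⊤) Measurable.of_discrete,
      ae_map_iff Measurable.of_discrete.aemeasurable MeasurableSet.of_discrete]
    exact Eventually.of_forall fun k => ENat.natCast_lt_top k
  filter_upwards [hfin] with ω hω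
  obtain ⟨n, hn⟩ := exists_nat_gt ‖Y 0 ω‖
  have hS : {i | Y i ω ∈ Metric.ball 0 n}.Finite := Set.encard_lt_top_iff.1 (hω n)
  obtain ⟨i, hi, hmin⟩ := Set.exists_min_image _ (fun i => ‖Y i ω‖) hS ⟨0, by simpa using hn⟩
  refine ⟨i, le_antisymm (le_nearestDist_iff.2 fun j => ?_) (ciInf_le (bddBelow_norm _) i)⟩
  by_cases hj : Y j ω ∈ Metric.ball 0 n
  · exact hmin j hj
  · simp only [Metric.mem_ball, dist_zero_right, not_lt, Set.mem_ofPred_eq] at hj hi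
    exact hi.le.trans hj

/-- The tail of the density of the distance to the nearest point. -/
lemma setLIntegral_Ioi_nearest_density (hlam : 0 < lam) {a : ℝ} (ha : 0 ≤ a) :
    ∫⁻ v in Set.Ioi a, ENNReal.ofReal (2 * Real.pi * lam * v * Real.exp (-(Real.pi * lam * v ^ 2)))
      = ENNReal.ofReal (Real.exp (-(Real.pi * lam * a ^ 2))) := by
  have hpos : ∀ v ∈ Set.Ioi a,
      0 ≤ 2 * Real.pi * lam * v * Real.exp (-(Real.pi * lam * v ^ 2)) := fun v hv => by
    have : 0 < v := ha.trans_lt hv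
    positivity
  refine setLIntegral_ofReal_of_integral_eq measurableSet_Ioi hpos (Real.exp_pos _) ?_
  have hderiv : ∀ v ∈ Set.Ici a, HasDerivAt (fun v => -Real.exp (-(Real.pi * lam * v ^ 2)))
      (2 * Real.pi * lam * v * Real.exp (-(Real.pi * lam * v ^ 2))) v := fun v _ => by
    have h := (((hasDerivAt_pow 2 v).const_mul (Real.pi * lam)).neg.exp).neg
    refine h.congr_deriv ?_
    norm_num
    ring
  have hlim : Tendsto (fun v => -Real.exp (-(Real.pi * lam * v ^ 2))) atTop (𝓝 (-0)) :=
    (Real.tendsto_exp_neg_atTop_nhds_zero.comp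
      ((tendsto_pow_atTop two_ne_zero).const_mul_atTop (by positivity))).neg
  rw [integral_Ioi_of_hasDerivAt_of_nonneg' hderiv hpos hlim]
  ring

/-- The distance to the nearest point of a Poisson process has density `2πλ v e^{-πλv²}`. -/
lemma IsHomogeneousPPP.map_nearestDist [IsProbabilityMeasure μ] (hY : IsHomogeneousPPP Y lam μ)
    (hlam : 0 < lam) :
    μ.map (fun ω => nearestDist fun i => Y i ω) = (volume.restrict (Set.Ioi 0)).withDensity
      fun v => ENNReal.ofReal (2 * Real.pi * lam * v * Real.exp (-(Real.pi * lam * v ^ 2))) := by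
  have hm := hY.measurable_nearestDist
  have : IsProbabilityMeasure (μ.map fun ω => nearestDist fun i => Y i ω) :=
    Measure.isProbabilityMeasure_map hm.aemeasurable
  refine Measure.ext_of_Ici _ _ fun a => ?_
  rw [withDensity_apply _ measurableSet_Ici, Measure.restrict_restrict measurableSet_Ici]
  have h1 : μ.map (fun ω => nearestDist fun i => Y i ω) (Set.Ici a)
      = μ {ω | max a 0 ≤ nearestDist fun i => Y i ω} := by
    rw [Measure.map_apply hm measurableSet_Ici]
    congr 1
    ext ω
    have : 0 ≤ nearestDist fun i => Y i ω := le_nearestDist_iff.2 fun i => norm_nonneg _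
    simp [this]
  rw [h1, hY.measure_le_nearestDist hlam (le_max_right _ _),
    ← setLIntegral_Ioi_nearest_density hlam (le_max_right a 0)]
  refine setLIntegral_congr ?_
  rcases le_or_gt a 0 with ha | ha
  · rw [max_eq_right ha, Set.inter_eq_right.2 (Set.Ioi_subset_Ici ha)]
    exact EventuallyEq.rfl
  · rw [max_eq_left ha.le, Set.inter_eq_left.2 (Set.Ici_subset_Ioi.2 ha)]
    exact Ioi_ae_eq_Ici

lemma IsHomogeneousPPP.setLIntegral_nearestDist [IsProbabilityMeasure μ]
    (hY : IsHomogeneousPPP Y lam μ) (hlam : 0 < lam) (hD : 0 < D) {f : ℝ → ℝ≥0∞}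
    (hf : Measurable f) :
    ∫⁻ ω in {ω | D < nearestDist fun i => Y i ω}, f (nearestDist fun i => Y i ω) ∂μ
      = ∫⁻ v in Set.Ioi D, ENNReal.ofReal
          (2 * Real.pi * lam * v * Real.exp (-(Real.pi * lam * v ^ 2))) * f v := by
  have hm := hY.measurable_nearestDist
  have h1 := setLIntegral_map (μ := μ) (measurableSet_Ioi (a := D)) hf hm
  rw [hY.map_nearestDist hlam] at h1
  refine h1.symm.trans ?_
  rw [setLIntegral_withDensity_eq_setLIntegral_mul _ (by fun_prop) hf measurableSet_Ioi,
    Measure.restrict_restrict measurableSet_Ioi,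
    Set.inter_eq_left.2 (Set.Ioi_subset_Ioi hD.le)]
  rfl

end NearestPoint

/-! ### The exponent `g` and the integrand of the bound -/

lemma gExponent_nonneg {lam₂ D P α s v : ℝ} (hlam₂ : 0 < lam₂) (hD : 0 < D) (hP : 0 < P)
    (hs : 0 < s) (hv : D < v) : 0 ≤ gExponent lam₂ D P α s v :=
  intervalIntegral.integral_nonneg (by linarith) fun _ hr =>
    gIntegrand_nonneg hlam₂ hP hs (by linarith [hr.1])

/-- The mass outside a hole is the total mass minus the exponent `g`; in particular `g` is bounded
by the total mass. -/
lemma lintegral_compl_hole_gain {lam₂ D P α s : ℝ} (hlam₂ : 0 < lam₂) (hD : 0 < D) (hP : 0 < P)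
    (hα : 2 < α) (hs : 0 < s) {y : Plane} (hy : D < ‖y‖) :
    gExponent lam₂ D P α s ‖y‖ ≤ Real.pi * lam₂ * ((s * P) ^ (2 / α) / nsinc (2 / α)) ∧
    ENNReal.ofReal lam₂ *
        ∫⁻ x in (Metric.ball y D)ᶜ, ENNReal.ofReal (1 / (1 + ‖x‖ ^ α / (P * s)))
      = ENNReal.ofReal (Real.pi * lam₂ * ((s * P) ^ (2 / α) / nsinc (2 / α))
          - gExponent lam₂ D P α s ‖y‖) := by
  set A := ENNReal.ofReal lam₂ *
        ∫⁻ x in (Metric.ball y D)ᶜ, ENNReal.ofReal (1 / (1 + ‖x‖ ^ α / (P * s)))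
  have hg := gExponent_nonneg (α := α) hlam₂ hD hP hs hy
  have hsum : ENNReal.ofReal (gExponent lam₂ D P α s ‖y‖) + A
      = ENNReal.ofReal (Real.pi * lam₂ * ((s * P) ^ (2 / α) / nsinc (2 / α))) := by
    rw [← lintegral_hole_gain hlam₂ hD hP hα hs hy, ← mul_add,
      lintegral_add_compl _ Metric.isOpen_ball.measurableSet, lintegral_plane_gain hP hα hs,
      ← ENNReal.ofReal_mul hlam₂.le]
    ring_nf
  constructor
  · -- If `g = 0`, the identity `hsum` gives no bound in `ℝ`, and the sign of `nsinc` is needed.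
    rcases hg.eq_or_lt with h0 | h0
    · have hsin : 0 ≤ nsinc (2 / α) := by
        have hα0 : 0 < α := by linarith
        have h2 : 2 / α ≤ 1 := by rw [div_le_one hα0]; exact hα.le
        have h3 : Real.pi * (2 / α) ≤ Real.pi := mul_le_of_le_one_right Real.pi_pos.le h2
        have h4 : 0 < Real.pi * (2 / α) := by positivity
        rw [nsinc, Real.sinc_of_ne_zero h4.ne']
        exact div_nonneg (Real.sin_nonneg_of_nonneg_of_le_pi h4.le h3) h4.le
      rw [← h0]
      positivity
    · refine (ENNReal.ofReal_le_ofReal_iff' |>.1 (hsum ▸ le_self_add)).resolve_right (by linarith)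
  · rw [ENNReal.ofReal_sub _ hg, ← hsum, ENNReal.add_sub_cancel_left ENNReal.ofReal_ne_top]

/-- The exponent `g`, extended by zero to `v ≤ D`, is a measurable function of `v`. -/
lemma measurable_indicator_gExponent {lam₂ D P α s : ℝ} (hlam₂ : 0 < lam₂) (hD : 0 < D)
    (hP : 0 < P) (hα : 2 < α) (hs : 0 < s) :
    Measurable ((Set.Ioi D).indicator (gExponent lam₂ D P α s)) := by
  -- `q v` is `λ₂` times the mass of the hole around `(v, 0)`, a parametric integral.
  let q : ℝ → ℝ≥0∞ := fun v => ENNReal.ofReal lam₂ * ∫⁻ x : Plane,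
    {p : ℝ × Plane | dist p.2 (p.1 • EuclideanSpace.single (0 : Fin 2) (1 : ℝ)) < D}.indicator
      (fun p => ENNReal.ofReal (1 / (1 + ‖p.2‖ ^ α / (P * s)))) (v, x)
  have hq : Measurable q := by
    refine measurable_const.mul (Measurable.lintegral_prod_right' (Measurable.indicator ?_ ?_))
    · fun_prop
    · exact measurableSet_lt (by fun_prop) measurable_const
  have heq : (Set.Ioi D).indicator (gExponent lam₂ D P α s)
      = (Set.Ioi D).indicator fun v => (q v).toReal := by
    refine Set.indicator_congr fun v (hv : D < v) => ?_
    have hnorm : ‖v • EuclideanSpace.single (0 : Fin 2) (1 : ℝ)‖ = v := by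
      simp [norm_smul, abs_of_pos (hD.trans hv)]
    have hqv : q v = ENNReal.ofReal (gExponent lam₂ D P α s v) := by
      have h1 := lintegral_hole_gain hlam₂ hD hP hα hs
        (y := v • EuclideanSpace.single (0 : Fin 2) (1 : ℝ)) (by rwa [hnorm])
      rw [hnorm, ← lintegral_indicator Metric.isOpen_ball.measurableSet] at h1
      exact h1
    simp only [hqv, ENNReal.toReal_ofReal (gExponent_nonneg hlam₂ hD hP hs hv)]
  rw [heq]
  exact hq.ennreal_toReal.indicator measurableSet_Ioi

/-- The integrand is dominated by a constant multiple of the density of the nearest distance, as `g`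
is bounded. -/
lemma integrableOn_boundIntegrand {lam₁ lam₂ D P α s : ℝ} (hlam₁ : 0 < lam₁) (hlam₂ : 0 < lam₂)
    (hD : 0 < D) (hP : 0 < P) (hα : 2 < α) (hs : 0 < s) :
    IntegrableOn (boundIntegrand lam₁ lam₂ D P α s) (Set.Ioi D) := by
  set K := Real.pi * lam₂ * ((s * P) ^ (2 / α) / nsinc (2 / α))
  have hdens : IntegrableOn (fun v => Real.exp (Real.pi * lam₁ * D ^ 2) *
      (2 * Real.pi * lam₁ * v * Real.exp (-(Real.pi * lam₁ * v ^ 2)))) (Set.Ioi D) := by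
    refine Integrable.const_mul ⟨by fun_prop, ?_⟩ _
    rw [hasFiniteIntegral_iff_ofReal, setLIntegral_Ioi_nearest_density hlam₁ hD.le]
    · exact ENNReal.ofReal_lt_top
    · refine ae_restrict_of_forall_mem measurableSet_Ioi fun v (hv : D < v) => ?_
      have := hD.trans hv
      positivity
  refine ((hdens.const_mul (Real.exp K)).mono' ?_ ?_)
  · have hm : Measurable fun v => Real.exp ((Set.Ioi D).indicator (gExponent lam₂ D P α s) v) *
        (2 * Real.pi * lam₁ * v * Real.exp (-(Real.pi * lam₁ * (v ^ 2 - D ^ 2)))) :=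
      (Real.measurable_exp.comp (measurable_indicator_gExponent hlam₂ hD hP hα hs)).mul
        (by fun_prop)
    refine hm.aestronglyMeasurable.congr
      (ae_restrict_of_forall_mem measurableSet_Ioi fun v hv => ?_)
    simp only [Set.indicator_of_mem hv, boundIntegrand]
  · refine ae_restrict_of_forall_mem measurableSet_Ioi fun v (hv : D < v) => ?_
    have hv0 := hD.trans hv
    have hnorm : ‖EuclideanSpace.single (0 : Fin 2) v‖ = v := by simp [hv0.le]
    have hgK := (lintegral_compl_hole_gain hlam₂ hD hP hα hs
      (y := EuclideanSpace.single (0 : Fin 2) v) (by rwa [hnorm])).1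
    rw [hnorm] at hgK
    have hexp : Real.exp (-(Real.pi * lam₁ * (v ^ 2 - D ^ 2)))
        = Real.exp (Real.pi * lam₁ * D ^ 2) * Real.exp (-(Real.pi * lam₁ * v ^ 2)) := by
      rw [← Real.exp_add]
      ring_nf
    rw [boundIntegrand, Real.norm_of_nonneg (by positivity), hexp]
    refine (mul_le_mul_of_nonneg_right (Real.exp_le_exp.2 hgK) (by positivity)).trans_eq ?_
    ring

/-! ### The interference and its Laplace transform -/

section Interference

variable {Ω : Type*} [MeasurableSpace Ω] {μ : Measure Ω} {X Y : ℕ → Ω → Plane} {h : ℕ → Ω → ℝ}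
  {lam₁ lam₂ D P α s : ℝ}

lemma interference_eq_tsum_indicator {Ω : Type*} (X Y : ℕ → Ω → Plane) (h : ℕ → Ω → ℝ)
    (D P α : ℝ) (ω : Ω) :
    interference X Y h D P α ω = ∑' i, {ω | ∀ j, D ≤ dist (X i ω) (Y j ω)}.indicator
      (fun ω => ENNReal.ofReal (P * h i ω * ‖X i ω‖ ^ (-α))) ω := by
  refine (tsum_subtype {i | X i ω ∈ holeProcess X Y D ω}
    (fun i => ENNReal.ofReal (P * h i ω * ‖X i ω‖ ^ (-α)))).trans (tsum_congr fun i => ?_)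
  have : i ∈ {i | X i ω ∈ holeProcess X Y D ω} ↔ ω ∈ {ω | ∀ j, D ≤ dist (X i ω) (Y j ω)} := by
    simp [holeProcess, points, holeRegion]
  by_cases hi : ω ∈ {ω | ∀ j, D ≤ dist (X i ω) (Y j ω)}
  · rw [Set.indicator_of_mem hi, Set.indicator_of_mem (this.2 hi)]
  · rw [Set.indicator_of_notMem hi, Set.indicator_of_notMem (mt this.1 hi)]

lemma measurable_interference (hX : ∀ i, Measurable (X i)) (hY : ∀ i, Measurable (Y i))
    (hh : ∀ i, Measurable (h i)) (D P α : ℝ) : Measurable (interference X Y h D P α) := by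
  simp_rw [funext (interference_eq_tsum_indicator X Y h D P α)]
  refine Measurable.tsum fun i => Measurable.indicator (by fun_prop) ?_
  have : {ω | ∀ j, D ≤ dist (X i ω) (Y j ω)} = ⋂ j, {ω | D ≤ dist (X i ω) (Y j ω)} := by
    ext; simp
  rw [this]
  exact MeasurableSet.iInter fun j => measurableSet_le measurable_const ((hX i).dist (hY j))

/-- Removing only one of the holes increases the interference. -/
lemma mul_interference_le {Ω : Type*} (X Y : ℕ → Ω → Plane) (h : ℕ → Ω → ℝ) (D P α : ℝ)
    (hs : 0 < s) (ω : Ω) (k : ℕ) :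
    ENNReal.ofReal s * interference X Y h D P α ω ≤
      ∑' i, ENNReal.ofReal ((Metric.ball (Y k ω) D)ᶜ.indicator
        (fun x => s * P * ‖x‖ ^ (-α)) (X i ω) * h i ω) := by
  rw [interference_eq_tsum_indicator, ← ENNReal.tsum_mul_left]
  refine ENNReal.tsum_le_tsum fun i => ?_
  by_cases hi : ω ∈ {ω | ∀ j, D ≤ dist (X i ω) (Y j ω)}
  · have hi' : X i ω ∈ (Metric.ball (Y k ω) D)ᶜ := by simpa using hi k
    rw [Set.indicator_of_mem hi, Set.indicator_of_mem hi', ← ENNReal.ofReal_mul hs.le]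
    refine (congrArg ENNReal.ofReal ?_).le
    ring
  · simp [Set.indicator_of_notMem hi]

/-- The Laplace transform of the interference for a fixed configuration `y` of the hole centres,
bounded below through the hole around any one centre `y k`. -/
lemma ofReal_exp_le_lintegral_interference [IsProbabilityMeasure μ] (hlam₂ : 0 < lam₂)
    (hD : 0 < D) (hP : 0 < P) (hα : 2 < α) (hs : 0 < s) (hX : IsHomogeneousPPP X lam₂ μ)
    (hm : ∀ i, Measurable (h i)) (hh : ∀ i, HasLaw (h i) (expMeasure 1) μ)
    (hh_indep : iIndepFun h μ)
    (hXh : IndepFun (fun ω i => X i ω) (fun ω i => h i ω) μ) (y : ℕ → Plane) (k : ℕ)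
    (hk : D < ‖y k‖) :
    ENNReal.ofReal (Real.exp (gExponent lam₂ D P α s ‖y k‖
        - Real.pi * lam₂ * ((s * P) ^ (2 / α) / nsinc (2 / α))))
      ≤ ∫⁻ ω, expNeg (ENNReal.ofReal s * interference X (fun i _ => y i) h D P α ω) ∂μ := by
  let c : Plane → ℝ := (Metric.ball (y k) D)ᶜ.indicator fun x => s * P * ‖x‖ ^ (-α)
  have hc : ∀ x, 0 ≤ c x := fun x => Set.indicator_nonneg (fun x _ => by positivity) x
  have hcm : Measurable c := Measurable.indicator (by fun_prop)
    Metric.isOpen_ball.measurableSet.compl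
  have h1 := hX.expNeg_le_lintegral_shotNoise hm hh hh_indep hXh hc hcm
  obtain ⟨hgK, hcompl⟩ := lintegral_compl_hole_gain hlam₂ hD hP hα hs hk
  have h2 : ∫⁻ x, ENNReal.ofReal (c x / (1 + c x))
      ≤ ∫⁻ x in (Metric.ball (y k) D)ᶜ, ENNReal.ofReal (1 / (1 + ‖x‖ ^ α / (P * s))) := by
    rw [← lintegral_indicator Metric.isOpen_ball.measurableSet.compl]
    refine lintegral_mono fun x => ?_
    by_cases hx : x ∈ (Metric.ball (y k) D)ᶜ
    · simp only [c, Set.indicator_of_mem hx]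
      refine ENNReal.ofReal_le_ofReal ?_
      rcases (norm_nonneg x).eq_or_lt with h0 | h0
      · -- At `x = 0` the path loss `0 ^ (-α)` is `0` by convention, and the inequality is strict.
        rw [← h0, Real.zero_rpow (by linarith)]
        simp
        positivity
      · rw [Real.rpow_neg h0.le]
        have : 0 < ‖x‖ ^ α := by positivity
        refine le_of_eq ?_
        field_simp
        ring
    · simp [c, Set.indicator_of_notMem hx]
  calc _ = expNeg (ENNReal.ofReal lam₂ *
        ∫⁻ x in (Metric.ball (y k) D)ᶜ, ENNReal.ofReal (1 / (1 + ‖x‖ ^ α / (P * s)))) := by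
        rw [hcompl, expNeg_ofReal (sub_nonneg.2 hgK), neg_sub]
    _ ≤ _ := expNeg_antitone (mul_le_mul_right h2 _)
    _ ≤ _ := h1
    _ ≤ _ := lintegral_mono fun ω => expNeg_antitone
        (mul_interference_le X (fun i _ => y i) h D P α hs ω k)

/-- Averaging over the hole centres, of which only the nearest one is kept. -/
lemma setLIntegral_nearestDist_le_interference [IsProbabilityMeasure μ] (hlam₂ : 0 < lam₂)
    (hD : 0 < D) (hP : 0 < P) (hα : 2 < α) (hs : 0 < s)
    (hY : IsHomogeneousPPP Y lam₁ μ) (hX : IsHomogeneousPPP X lam₂ μ)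
    (hm : ∀ i, Measurable (h i)) (hh : ∀ i, HasLaw (h i) (expMeasure 1) μ)
    (hh_indep : iIndepFun h μ)
    (hXh : IndepFun (fun ω i => X i ω) (fun ω i => h i ω) μ)
    (hYXh : IndepFun (fun ω i => Y i ω) (fun ω => ((fun i => X i ω), (fun i => h i ω))) μ) :
    ∫⁻ ω in {ω | D < nearestDist fun i => Y i ω},
        ENNReal.ofReal (Real.exp (gExponent lam₂ D P α s (nearestDist fun i => Y i ω)
          - Real.pi * lam₂ * ((s * P) ^ (2 / α) / nsinc (2 / α)))) ∂μ
      ≤ ∫⁻ ω in typicalEvent Y D,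
          expNeg (ENNReal.ofReal s * interference X Y h D P α ω) ∂μ := by
  have hYm : Measurable fun ω i => Y i ω := measurable_pi_lambda _ hY.measurable
  have hXhm : Measurable fun ω => ((fun i => X i ω), (fun i => h i ω)) :=
    (measurable_pi_lambda _ hX.measurable).prodMk (measurable_pi_lambda _ hm)
  have key := fun ω k => ofReal_exp_le_lintegral_interference hlam₂ hD hP hα hs hX hm hh hh_indep
    hXh (fun i => Y i ω) k
  let J : (ℕ → Plane) × ((ℕ → Plane) × (ℕ → ℝ)) → ℝ≥0∞ :=
    interference (fun i p => p.2.1 i) (fun i p => p.1 i) (fun i p => p.2.2 i) D P α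
  have hJ : Measurable J := measurable_interference (fun i => by fun_prop) (fun i => by fun_prop)
    (fun i => by fun_prop) D P α
  let A : Set (ℕ → Plane) := {y | D < nearestDist y}
  have hA : MeasurableSet A := measurableSet_lt measurable_const measurable_nearestDist
  let F : (ℕ → Plane) × ((ℕ → Plane) × (ℕ → ℝ)) → ℝ≥0∞ :=
    (Prod.fst ⁻¹' A).indicator fun p => expNeg (ENNReal.ofReal s * J p)
  have hF : Measurable F :=
    (measurable_expNeg.comp (measurable_const.mul hJ)).indicator (measurable_fst hA)
  have hAΩ : MeasurableSet {ω | D < nearestDist fun i => Y i ω} := hYm hA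
  have hFA : ∀ y p, D < nearestDist y → F (y, p) = expNeg (ENNReal.ofReal s * J (y, p)) :=
    fun y p hy => Set.indicator_of_mem (show (y, p) ∈ Prod.fst ⁻¹' A from hy) _
  have hJeq : ∀ y ω, J (y, (fun i => X i ω, fun i => h i ω))
      = interference X (fun i _ => y i) h D P α ω := fun y ω => rfl
  calc _ = ∫⁻ ω, {ω | D < nearestDist fun i => Y i ω}.indicator (fun ω =>
          ENNReal.ofReal (Real.exp (gExponent lam₂ D P α s (nearestDist fun i => Y i ω)
          - Real.pi * lam₂ * ((s * P) ^ (2 / α) / nsinc (2 / α))))) ω ∂μ :=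
        (lintegral_indicator hAΩ _).symm
    _ ≤ ∫⁻ ω, ∫⁻ ω', F (fun i => Y i ω, (fun i => X i ω', fun i => h i ω')) ∂μ ∂μ := by
        refine lintegral_mono_ae ?_
        filter_upwards [hY.exists_norm_eq_nearestDist] with ω ⟨k, hk⟩
        refine Set.indicator_apply_le' (fun (hω : D < nearestDist fun i => Y i ω) => ?_)
          fun _ => zero_le
        simp only [hFA _ _ hω, hJeq]
        rw [← hk]
        exact key ω k (hω.trans_eq hk.symm)
    _ = ∫⁻ ω, F (fun i => Y i ω, (fun i => X i ω, fun i => h i ω)) ∂μ :=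
        (lintegral_comp_prodMk_of_indepFun hYm hXhm hYXh hF).symm
    _ = ∫⁻ ω, {ω | D < nearestDist fun i => Y i ω}.indicator (fun ω =>
          expNeg (ENNReal.ofReal s * interference X Y h D P α ω)) ω ∂μ := rfl
    _ = ∫⁻ ω in {ω | D < nearestDist fun i => Y i ω},
          expNeg (ENNReal.ofReal s * interference X Y h D P α ω) ∂μ := lintegral_indicator hAΩ _
    _ ≤ _ := by
        rw [typicalEvent_eq]
        exact lintegral_mono_set fun ω (hω : D < _) => hω.le

/-- The Laplace transform as a Lebesgue integral. -/
lemma ofReal_laplace {ν : Measure Ω} [IsFiniteMeasure ν] {I : Ω → ℝ≥0∞} (hI : Measurable I)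
    (hs : 0 < s) : ENNReal.ofReal (laplace ν I s) = ∫⁻ ω, expNeg (ENNReal.ofReal s * I ω) ∂ν := by
  have h1 : ∀ ω, (if I ω = ∞ then 0 else Real.exp (-(s * (I ω).toReal)))
      = (expNeg (ENNReal.ofReal s * I ω)).toReal := by
    intro ω
    split_ifs with hω
    · rw [hω, ENNReal.mul_top (by simpa using hs), expNeg_top, ENNReal.toReal_zero]
    · rw [← ENNReal.ofReal_toReal hω, ← ENNReal.ofReal_mul hs.le,
        expNeg_ofReal (by positivity), ENNReal.toReal_ofReal (Real.exp_pos _).le,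
        ENNReal.toReal_ofReal ENNReal.toReal_nonneg]
  have hle : ∫⁻ ω, expNeg (ENNReal.ofReal s * I ω) ∂ν ≠ ∞ := by
    refine ((lintegral_mono fun ω => expNeg_le_one _).trans_lt ?_).ne
    simp
  have hmeas : Measurable fun ω => expNeg (ENNReal.ofReal s * I ω) :=
    measurable_expNeg.comp (measurable_const.mul hI)
  simp_rw [laplace, h1]
  rw [integral_toReal hmeas.aemeasurable
    (Eventually.of_forall fun ω => (expNeg_le_one _).trans_lt ENNReal.one_lt_top),
    ENNReal.ofReal_toReal hle]

/-- The lower bound for measurable gains. -/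
lemma bound_le_laplace [IsProbabilityMeasure μ] (hlam₁ : 0 < lam₁) (hlam₂ : 0 < lam₂)
    (hD : 0 < D) (hP : 0 < P) (hα : 2 < α) (hs : 0 < s)
    (hY : IsHomogeneousPPP Y lam₁ μ) (hX : IsHomogeneousPPP X lam₂ μ)
    (hm : ∀ i, Measurable (h i)) (hh : ∀ i, HasLaw (h i) (expMeasure 1) μ)
    (hh_indep : iIndepFun h μ)
    (hXh : IndepFun (fun ω i => X i ω) (fun ω i => h i ω) μ)
    (hYXh : IndepFun (fun ω i => Y i ω) (fun ω => ((fun i => X i ω), (fun i => h i ω))) μ) :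
    Real.exp (-(Real.pi * lam₂ * ((s * P) ^ (2 / α) / nsinc (2 / α)))) *
        ∫ v in Set.Ioi D, boundIntegrand lam₁ lam₂ D P α s v
      ≤ laplace (cond μ (typicalEvent Y D)) (interference X Y h D P α) s := by
  set K := Real.pi * lam₂ * ((s * P) ^ (2 / α) / nsinc (2 / α))
  have hT : MeasurableSet (typicalEvent Y D) := by
    rw [typicalEvent_eq]
    exact measurableSet_le measurable_const hY.measurable_nearestDist
  have hμT : μ (typicalEvent Y D) = ENNReal.ofReal (Real.exp (-(Real.pi * lam₁ * D ^ 2))) := by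
    rw [typicalEvent_eq, hY.measure_le_nearestDist hlam₁ hD.le]
  have hint := integrableOn_boundIntegrand hlam₁ hlam₂ hD hP hα hs
  have hnonneg : ∀ v ∈ Set.Ioi D, 0 ≤ boundIntegrand lam₁ lam₂ D P α s v := fun v hv => by
    have : 0 < v := hD.trans hv
    unfold boundIntegrand
    positivity
  have hlap : 0 ≤ laplace (cond μ (typicalEvent Y D)) (interference X Y h D P α) s :=
    integral_nonneg fun ω => by dsimp only; split_ifs <;> positivity
  have hmI := measurable_interference hX.measurable hY.measurable hm D P α
  rw [← ENNReal.ofReal_le_ofReal_iff hlap, ofReal_laplace hmI hs, ProbabilityTheory.cond,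
    lintegral_smul_measure, ENNReal.ofReal_mul (Real.exp_pos _).le,
    ofReal_integral_eq_lintegral_ofReal hint (ae_restrict_of_forall_mem measurableSet_Ioi hnonneg)]
  have hcore := setLIntegral_nearestDist_le_interference hlam₂ hD hP hα hs hY hX hm hh hh_indep
    hXh hYXh
  let f : ℝ → ℝ≥0∞ := fun v =>
    ENNReal.ofReal (Real.exp ((Set.Ioi D).indicator (gExponent lam₂ D P α s) v - K))
  have hf : Measurable f := (Real.measurable_exp.comp
    ((measurable_indicator_gExponent hlam₂ hD hP hα hs).sub_const K)).ennreal_ofReal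
  have h1 : ∫⁻ ω in {ω | D < nearestDist fun i => Y i ω},
        ENNReal.ofReal (Real.exp (gExponent lam₂ D P α s (nearestDist fun i => Y i ω) - K)) ∂μ
      = ∫⁻ v in Set.Ioi D, ENNReal.ofReal
          (2 * Real.pi * lam₁ * v * Real.exp (-(Real.pi * lam₁ * v ^ 2))) * f v := by
    rw [← hY.setLIntegral_nearestDist hlam₁ hD hf]
    refine setLIntegral_congr_fun (measurableSet_lt measurable_const hY.measurable_nearestDist)
      fun ω hω => ?_
    simp only [f]
    rw [Set.indicator_of_mem (s := Set.Ioi D) hω]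
  rw [h1] at hcore
  refine le_trans (le_of_eq ?_) (mul_le_mul_right hcore _)
  rw [hμT, ← ENNReal.ofReal_inv_of_pos (Real.exp_pos _), ← Real.exp_neg, neg_neg,
    ← lintegral_const_mul' _ _ ENNReal.ofReal_ne_top,
    ← lintegral_const_mul' _ _ ENNReal.ofReal_ne_top]
  refine setLIntegral_congr_fun measurableSet_Ioi fun v hv => ?_
  have hv0 : 0 < v := hD.trans hv
  simp only [f]
  rw [Set.indicator_of_mem hv, ← ENNReal.ofReal_mul (Real.exp_pos _).le,
    ← ENNReal.ofReal_mul (by positivity), ← ENNReal.ofReal_mul (Real.exp_pos _).le, boundIntegrand]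
  congr 1
  rw [show -(Real.pi * lam₁ * (v ^ 2 - D ^ 2))
      = Real.pi * lam₁ * D ^ 2 + -(Real.pi * lam₁ * v ^ 2) by ring, sub_eq_add_neg, Real.exp_add,
    Real.exp_add]
  ring

end Interference

end PoissonHole

theorem theorem1 {Ω : Type*} [MeasurableSpace Ω] (μ : Measure Ω) [IsProbabilityMeasure μ]
    (lam₁ lam₂ D P α s : ℝ) (hlam₁ : 0 < lam₁) (hlam₂ : 0 < lam₂) (hD : 0 < D) (hP : 0 < P)
    (hα : 2 < α) (hs : 0 < s)
    -- hole centres `Y`, baseline points `X`, fading gains `h`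
    (Y X : ℕ → Ω → PoissonHole.Plane) (h : ℕ → Ω → ℝ)
    (hY : PoissonHole.IsHomogeneousPPP Y lam₁ μ)
    (hX : PoissonHole.IsHomogeneousPPP X lam₂ μ)
    (hh : ∀ i, HasLaw (h i) (expMeasure 1) μ)
    (hh_indep : iIndepFun h μ)
    -- the three sequences `Y`, `X`, `h` are mutually independent
    (hXh : IndepFun (fun ω i => X i ω) (fun ω i => h i ω) μ)
    (hYXh : IndepFun (fun ω i => Y i ω) (fun ω => ((fun i => X i ω), (fun i => h i ω))) μ) :
    (∀ v, D < v → IntervalIntegrable (PoissonHole.gIntegrand lam₂ D P α s v) volume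
      (v - D) (v + D)) ∧
    IntegrableOn (PoissonHole.boundIntegrand lam₁ lam₂ D P α s) (Set.Ioi D) ∧
    Real.exp (-(Real.pi * lam₂ * ((s * P) ^ (2 / α) / PoissonHole.nsinc (2 / α)))) *
        ∫ v in Set.Ioi D, PoissonHole.boundIntegrand lam₁ lam₂ D P α s v
      ≤ PoissonHole.laplace (ProbabilityTheory.cond μ (PoissonHole.typicalEvent Y D))
          (PoissonHole.interference X Y h D P α) s := by
  refine ⟨fun v hv => PoissonHole.intervalIntegrable_gIntegrand hD hP hα hs hv,
    PoissonHole.integrableOn_boundIntegrand hlam₁ hlam₂ hD hP hα hs, ?_⟩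
  -- The gains are only almost everywhere measurable: pass to measurable versions.
  let h' : ℕ → Ω → ℝ := fun i => (hh i).aemeasurable.mk (h i)
  have hh' : ∀ i, h i =ᵐ[μ] h' i := fun i => (hh i).aemeasurable.ae_eq_mk
  have hseq : (fun ω i => h i ω) =ᵐ[μ] fun ω i => h' i ω := by
    filter_upwards [ae_all_iff.2 hh'] with ω hω
    exact funext hω
  have hpair : (fun ω => ((fun i => X i ω), (fun i => h i ω)))
      =ᵐ[μ] fun ω => ((fun i => X i ω), (fun i => h' i ω)) := by
    filter_upwards [hseq] with ω hω
    rw [hω]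
  have hI : PoissonHole.interference X Y h D P α =ᵐ[ProbabilityTheory.cond μ
      (PoissonHole.typicalEvent Y D)] PoissonHole.interference X Y h' D P α := by
    refine ProbabilityTheory.cond_absolutelyContinuous.ae_le ?_
    filter_upwards [hseq] with ω hω
    simp only [PoissonHole.interference, fun i => congrFun hω i]
  have hlap : PoissonHole.laplace (ProbabilityTheory.cond μ (PoissonHole.typicalEvent Y D))
        (PoissonHole.interference X Y h D P α) s
      = PoissonHole.laplace (ProbabilityTheory.cond μ (PoissonHole.typicalEvent Y D))
        (PoissonHole.interference X Y h' D P α) s := by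
    refine integral_congr_ae ?_
    filter_upwards [hI] with ω hω
    rw [hω]
  rw [hlap]
  exact PoissonHole.bound_le_laplace hlam₁ hlam₂ hD hP hα hs hY hX
    (fun i => (hh i).aemeasurable.measurable_mk) (fun i => (hh i).congr (hh' i).symm)
    (hh_indep.congr hh') (hXh.congr Filter.EventuallyEq.rfl hseq)
    (hYXh.congr Filter.EventuallyEq.rfl hpair)
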